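/- Let $G_0$ be a triangle and, for $n\ge 0$, let $G_{n+1}$ be the graph obtained from $G_n$ by adding, for every edge of $G_n$, one new vertex joined to both ends of that edge (all old vertices and edges are kept); $G_n$ is the pseudofractal scale-free web. Let $N_n$ be the number of vertices of $G_n$. For a finite connected graph with $N$ vertices whose Laplacian matrix (degree matrix minus adjacency matrix) has the eigenvalues $0=\lambda_1<\lambda_2\le\dots\le\lambda_N$, put $$H_{\rm FO}=\frac1{2N}\sum_{i=2}^{N}\frac1{\lambda_i},\qquad H_{\rm SO}=\frac1{2N}\sum_{i=2}^{N}\frac1{\lambda_i^2},$$ and let $H_{\rm FO}(n)$, $H_{\rm SO}(n)$ be the values for $G_n$. Then for every $n\ge 1$ $$H_{\rm FO}(n)=\frac{25\cdot 2^n-7\cdot 3^n+8\cdot 3^{1+2n}+25\cdot 3^{1+3n}+5\cdot 6^{1+n}-35\cdot 18^n}{28\,(1+3^n)^2\,3^{2+n}}$$ and $$\begin{aligned}H_{\rm SO}(n)=\frac{3^{-4-2n}}{90160\,(1+3^n)^3}\Big(&69538\cdot 3^{2+5n}+360249\cdot 4^n+35\cdot 2^{2+n}\,3^{1+n}\,(-575+1539\cdot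 2^n)\\&+322\cdot 27^n\,(1135-3225\cdot 2^{1+n}+847\cdot 2^{1+2n})\\&+3^{1+4n}\,(516262-60375\cdot 2^{2+n}+140875\cdot 4^n)\\&+2\cdot 9^n\,(55223-94875\cdot 2^{1+n}+480487\cdot 4^n)\Big).\end{aligned}$$ Moreover, $\lim_{n\to\infty}H_{\rm FO}(n)=\frac{25}{84}$, and $$H_{\rm SO}(n)\sim\frac{25}{432}\Big(\frac{2N_n}{3}\Big)^{\log_3 4-1}\qquad(n\to\infty),$$ where $a_n\sim b_n$ means $a_n/b_n\to 1$. The exponent satisfies $0<\log_3 4-1<1$ and $H_{\rm SO}(n)=o(N_n)$; that is, $H_{\rm SO}(n)$ is sublinear in $N_n$. -/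

import Mathlib

open Filter Asymptotics

noncomputable section

/-- A finite simple graph together with its vertex type. -/
structure FinGraph where
  /-- the vertex type -/
  V : Type
  /-- there are finitely many vertices -/
  fin : Fintype V
  /-- the graph itself -/
  graph : SimpleGraph V

attribute [instance] FinGraph.fin

/-- The graph obtained from `G` by introducing, for every edge `e` of `G`, one new vertex that is
joined to the two ends of `e` (and to nothing else); all vertices and edges of `G` are kept.
Old vertices are `Sum.inl u`, the new vertex of the edge `e` is `Sum.inr e`. -/
def SimpleGraph.addEdgeVertices {V : Type} (G : SimpleGraph V) : SimpleGraph (V ⊕ G.edgeSet) where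
  Adj
    | Sum.inl u, Sum.inl v => G.Adj u v
    | Sum.inl u, Sum.inr e => u ∈ (e : Sym2 V)
    | Sum.inr e, Sum.inl u => u ∈ (e : Sym2 V)
    | Sum.inr _, Sum.inr _ => False
  symm := by
    constructor
    rintro (u | e) (v | f) h
    · exact G.adj_symm h
    · exact h
    · exact h
    · exact h
  loopless := by
    constructor
    rintro (u | e) h
    · exact G.loopless.irrefl u h
    · exact h

open Classical in
/-- The pseudofractal scale-free web `G_n`: `G_0` is a triangle, and `G_{n+1}` arises from `G_n`
by giving every edge a new vertex joined to both ends of the edge. -/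
def psfw : ℕ → FinGraph
  | 0 => ⟨Fin 3, inferInstance, ⊤⟩
  | n + 1 => ⟨(psfw n).V ⊕ (psfw n).graph.edgeSet, inferInstance, (psfw n).graph.addEdgeVertices⟩

/-- The number `N_n` of vertices of `G_n`. -/
def psfwCard (n : ℕ) : ℕ := Fintype.card (psfw n).V

open Classical in
/-- The eigenvalues of the Laplacian matrix (degree matrix minus adjacency matrix) of a finite
graph, listed with multiplicity and indexed by the vertices. -/
def FinGraph.lapEigenvalues (G : FinGraph) : G.V → ℝ :=
  (G.graph.isHermitian_lapMatrix (R := ℝ)).eigenvalues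

open Classical in
/-- First-order coherence `1/(2N) * ∑ 1/λ`, the sum over the nonzero Laplacian eigenvalues `λ`,
counted with multiplicity. -/
def FinGraph.firstOrderCoherence (G : FinGraph) : ℝ :=
  1 / (2 * (Fintype.card G.V : ℝ)) *
    ∑ i : G.V with G.lapEigenvalues i ≠ 0, 1 / G.lapEigenvalues i

open Classical in
/-- Second-order coherence `1/(2N) * ∑ 1/λ²`, the sum over the nonzero Laplacian eigenvalues `λ`,
counted with multiplicity. -/
def FinGraph.secondOrderCoherence (G : FinGraph) : ℝ :=
  1 / (2 * (Fintype.card G.V : ℝ)) *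
    ∑ i : G.V with G.lapEigenvalues i ≠ 0, 1 / G.lapEigenvalues i ^ 2

end

/-! The web renormalises under Schur complements. Eliminating the newest vertices, all of degree
two, from `x - p D + q A` gives a matrix of the same form on the previous graph with new responses
`p, q`, and each eliminated vertex contributes a factor `x - 2p`
(`det_networkMatrix_addEdgeVertices`). At `p = q = 1` the determinant is the Laplacian
characteristic polynomial, so `n` eliminations write it as an explicit product of such factors and
the determinant of a triangle.

The sums of `1/λ` and `1/λ²` depend only on the lowest coefficients of this product, and they add up
over its factors (`HasPowerSums`). Hence everything is done in `ℝ⟦X⟧`, with `p_k, q_k` known only to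
low order. Their coefficients obey triangular linear recurrences, solved by combinations of
monomials in `2 ^ k` and `3 ^ k` (`edgeResponseCoeffs`).

In the final formulas the sum of `1/λ` grows like `3 ^ n` and that of `1/λ²` like `4 ^ n`, while
`N_n` grows like `3 ^ n`. This gives a finite limit in the first case and growth `(4/3) ^ n` in the
second. -/

namespace SimpleGraph

open Matrix

/-! ### Incidence sums over the edge set -/

section Incidence

variable {V R : Type*} [CommRing R] (G : SimpleGraph V)

theorem sum_edgeSet_eq_sum_sym2 [Fintype (Sym2 V)] [Fintype G.edgeSet] (f : Sym2 V → R) (hf : ∀ e, e ∉ G.edgeSet → f e = 0) :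
    ∑ e : G.edgeSet, f e = ∑ e : Sym2 V, f e := by
  classical
  rw [← Finset.sum_filter_of_ne (p := (· ∈ G.edgeSet)) fun e _ he => by_contra fun h => he (hf e h),
    Finset.sum_subtype (p := (· ∈ G.edgeSet)) _ (by simp)]

variable [Fintype V] [DecidableEq V] [DecidableRel G.Adj]

theorem sum_edgeSet_ite_mem [Fintype G.edgeSet] (u : V) :
    ∑ e : G.edgeSet, (if u ∈ (e : Sym2 V) then (1 : R) else 0) = G.degree u := by
  rw [← G.sum_incMatrix_apply (R := R),
    ← G.sum_edgeSet_eq_sum_sym2 _ fun e he =>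
      G.incMatrix_of_notMem_incidenceSet fun h => he h.1]
  refine Finset.sum_congr rfl fun e _ => ?_
  simp [incMatrix_apply', incidenceSet, e.2]

theorem sum_edgeSet_ite_mem_mul_ite_mem [Fintype G.edgeSet] (u v : V) :
    ∑ e : G.edgeSet, (if u ∈ (e : Sym2 V) then (1 : R) else 0) *
        (if v ∈ (e : Sym2 V) then (1 : R) else 0) =
      if u = v then (G.degree u : R) else if G.Adj u v then 1 else 0 := by
  have h := congrFun (congrFun (G.incMatrix_mul_transpose (R := R)) u) v
  rw [Matrix.mul_apply] at h
  simp only [transpose_apply, of_apply] at h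
  rw [← h, ← G.sum_edgeSet_eq_sum_sym2 _ fun e he => by
      rw [G.incMatrix_of_notMem_incidenceSet fun h => he h.1, zero_mul]]
  refine Finset.sum_congr rfl fun e _ => ?_
  simp [incMatrix_apply', incidenceSet, e.2]

theorem sum_ite_mem_edge (e : G.edgeSet) :
    ∑ u : V, (if u ∈ (e : Sym2 V) then (1 : R) else 0) = 2 := by
  rw [← G.sum_incMatrix_apply_of_mem_edgeSet (R := R) e.2]
  refine Finset.sum_congr rfl fun u _ => ?_
  simp [incMatrix_apply', incidenceSet, e.2]

end Incidence

/-! ### Degrees and edge count after one generation -/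

section AddEdgeVertices

variable {V : Type} (G : SimpleGraph V)

@[simp]
theorem addEdgeVertices_adj_inl_inl (u v : V) :
    G.addEdgeVertices.Adj (Sum.inl u) (Sum.inl v) ↔ G.Adj u v := Iff.rfl

@[simp]
theorem addEdgeVertices_adj_inl_inr (u : V) (e : G.edgeSet) :
    G.addEdgeVertices.Adj (Sum.inl u) (Sum.inr e) ↔ u ∈ (e : Sym2 V) := Iff.rfl

@[simp]
theorem addEdgeVertices_adj_inr_inl (e : G.edgeSet) (u : V) :
    G.addEdgeVertices.Adj (Sum.inr e) (Sum.inl u) ↔ u ∈ (e : Sym2 V) := Iff.rfl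

@[simp]
theorem not_addEdgeVertices_adj_inr_inr (e f : G.edgeSet) :
    ¬ G.addEdgeVertices.Adj (Sum.inr e) (Sum.inr f) := id

variable [Fintype V] [DecidableEq V] [DecidableRel G.Adj]
  [Fintype G.edgeSet] [DecidableRel G.addEdgeVertices.Adj]

theorem degree_addEdgeVertices_inl (u : V) :
    G.addEdgeVertices.degree (Sum.inl u) = 2 * G.degree u := by
  have h := degree_eq_sum_if_adj G.addEdgeVertices (R := ℤ) (Sum.inl u)
  have h1 := degree_eq_sum_if_adj G (R := ℤ) u
  have h2 := G.sum_edgeSet_ite_mem (R := ℤ) u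
  simp only [Fintype.sum_sum_type, addEdgeVertices_adj_inl_inl, addEdgeVertices_adj_inl_inr] at h
  zify
  linarith

theorem degree_addEdgeVertices_inr (e : G.edgeSet) :
    G.addEdgeVertices.degree (Sum.inr e) = 2 := by
  have h := degree_eq_sum_if_adj G.addEdgeVertices (R := ℤ) (Sum.inr e)
  have h2 := G.sum_ite_mem_edge (R := ℤ) e
  simp only [Fintype.sum_sum_type, addEdgeVertices_adj_inr_inl, not_addEdgeVertices_adj_inr_inr,
    if_false, Finset.sum_const_zero, add_zero] at h
  zify
  linarith

/-- Handshake: old degrees double and every new vertex has degree two, so the degree sum `2E`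
becomes `4E + 2E`. -/
theorem natCard_edgeSet_addEdgeVertices :
    Nat.card G.addEdgeVertices.edgeSet = 3 * Nat.card G.edgeSet := by
  classical
  have h := G.addEdgeVertices.sum_degrees_eq_twice_card_edges
  have h' := G.sum_degrees_eq_twice_card_edges
  rw [Fintype.sum_sum_type] at h
  simp only [degree_addEdgeVertices_inl, degree_addEdgeVertices_inr, ← Finset.mul_sum, h',
    Finset.sum_const, Finset.card_univ, smul_eq_mul, edgeFinset_card,
    ← Nat.card_eq_fintype_card] at h
  omega

end AddEdgeVertices

/-! ### Schur complement and characteristic polynomial -/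

/-- The matrix `x - p D + q A`, with `D` the degree matrix and `A` the adjacency matrix: `x` minus
the response matrix of the network in which every edge of `G` is a symmetric two-terminal element
with response `p` on the diagonal and `-q` off the diagonal. -/
def networkMatrix {V R : Type*} [Fintype V] [DecidableEq V] [CommRing R] (G : SimpleGraph V)
    [DecidableRel G.Adj] (p q x : R) : Matrix V V R :=
  of fun u v => if u = v then x - p * G.degree u else if G.Adj u v then q else 0

/-- Elimination of the new vertices of `G.addEdgeVertices` by a Schur complement. -/
theorem det_networkMatrix_addEdgeVertices {V : Type} {R : Type*} [Fintype V] [DecidableEq V]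
    [CommRing R] (G : SimpleGraph V) [DecidableRel G.Adj] [Fintype G.edgeSet]
    [DecidableRel G.addEdgeVertices.Adj]
    (p q x r : R) (hr : r * (x - 2 * p) = 1) :
    (G.addEdgeVertices.networkMatrix p q x).det =
      (x - 2 * p) ^ Fintype.card G.edgeSet *
        (G.networkMatrix (2 * p + q ^ 2 * r) (q - q ^ 2 * r) x).det := by
  let B : Matrix V G.edgeSet R := of fun u e => if u ∈ (e : Sym2 V) then 1 else 0
  let S : Matrix G.edgeSet G.edgeSet R := (x - 2 * p) • 1
  let _ : Invertible S := ⟨r • 1, by simp only [S, smul_mul_smul_comm, hr, one_smul, mul_one],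
    by simp only [S, smul_mul_smul_comm, mul_comm _ r, hr, one_smul, mul_one]⟩
  have hS : ⅟S = r • 1 := rfl
  have hblock : G.addEdgeVertices.networkMatrix p q x =
      fromBlocks (G.networkMatrix (2 * p) q x) (q • B) (q • Bᵀ) S := by
    ext (u | e) (v | f)
    · simp [networkMatrix, degree_addEdgeVertices_inl]
      simp only [mul_left_comm, mul_assoc]
    · simp [networkMatrix, B]
    · simp [networkMatrix, B]
    · simp [networkMatrix, degree_addEdgeVertices_inr, S, Matrix.one_apply, mul_comm p]
  -- `B Bᵀ = D + A`, so the Schur correction `q² r B Bᵀ` only shifts the coefficients of `D` and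
  -- `A`.
  have hB : ∀ u v, (B * Bᵀ) u v =
      if u = v then (G.degree u : R) else if G.Adj u v then 1 else 0 := fun u v => by
    rw [← G.sum_edgeSet_ite_mem_mul_ite_mem, Matrix.mul_apply]
    rfl
  rw [hblock, det_fromBlocks₂₂, hS]
  congr 1
  · simp [S]
  · congr 1
    ext u v
    simp only [Matrix.smul_mul, Matrix.mul_smul, Matrix.mul_one, Matrix.sub_apply,
      Matrix.smul_apply, hB, smul_eq_mul]
    simp only [networkMatrix, of_apply]
    split_ifs <;> ring

/-- The adjacency matrix of the triangle has eigenvalues `2, -1, -1`. -/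
theorem det_networkMatrix_top_fin_three {R : Type*} [CommRing R]
    [DecidableRel (⊤ : SimpleGraph (Fin 3)).Adj] (p q x : R) :
    ((⊤ : SimpleGraph (Fin 3)).networkMatrix p q x).det =
      (x - 2 * p + 2 * q) * (x - 2 * p - q) ^ 2 := by
  have hd : ∀ i, (⊤ : SimpleGraph (Fin 3)).degree i = 2 := fun i => by
    convert complete_graph_degree i
    simp
  rw [det_fin_three]
  simp [networkMatrix, hd]
  ring

theorem det_networkMatrix_one_one {V R S : Type*} [Fintype V] [DecidableEq V] [CommRing R]
    [CommRing S] (G : SimpleGraph V) [DecidableRel G.Adj] (f : Polynomial R →+* S) :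
    (G.networkMatrix 1 1 (f Polynomial.X)).det = f (G.lapMatrix R).charpoly := by
  rw [charpoly, RingHom.map_det]
  congr 1
  ext u v
  by_cases h : u = v
  · subst h
    simp [networkMatrix, charmatrix, lapMatrix, degMatrix]
  · by_cases h' : G.Adj u v <;>
      simp [networkMatrix, charmatrix, lapMatrix, degMatrix, h, h', adjMatrix_apply]

end SimpleGraph

/-! ### Power sums of reciprocal roots from low coefficients -/

namespace PowerSeries

theorem coeff_one_mul_eq {R : Type*} [Semiring R] (f g : R⟦X⟧) :
    coeff 1 (f * g) = coeff 0 f * coeff 1 g + coeff 1 f * coeff 0 g := by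
  simp [coeff_mul, Finset.Nat.sum_antidiagonal_eq_sum_range_succ_mk, Finset.sum_range_succ]

theorem coeff_two_mul_eq {R : Type*} [Semiring R] (f g : R⟦X⟧) :
    coeff 2 (f * g) = coeff 0 f * coeff 2 g + coeff 1 f * coeff 1 g + coeff 2 f * coeff 0 g := by
  simp [coeff_mul, Finset.Nat.sum_antidiagonal_eq_sum_range_succ_mk, Finset.sum_range_succ]

theorem coeff_three_mul_eq {R : Type*} [Semiring R] (f g : R⟦X⟧) :
    coeff 3 (f * g) = coeff 0 f * coeff 3 g + coeff 1 f * coeff 2 g + coeff 2 f * coeff 1 g +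
      coeff 3 f * coeff 0 g := by
  simp [coeff_mul, Finset.Nat.sum_antidiagonal_eq_sum_range_succ_mk, Finset.sum_range_succ]

/-- `f` has nonzero constant coefficient, and `f / f(0) = 1 - a X + (a² - b) / 2 X² + O(X³)`:
if `f` is a polynomial, then `a` and `b` are the sums of the reciprocals and of the squared
reciprocals of its roots. -/
def HasPowerSums {K : Type*} [Field K] (f : K⟦X⟧) (a b : K) : Prop :=
  coeff 0 f ≠ 0 ∧ coeff 1 f = -a * coeff 0 f ∧ 2 * coeff 2 f = (a ^ 2 - b) * coeff 0 f

namespace HasPowerSums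

variable {K : Type*} [Field K] {f g : K⟦X⟧} {a b a' b' : K}

theorem of_coeff {f0 f1 f2 : K} (h : f0 ≠ 0) (h0 : coeff 0 f = f0) (h1 : coeff 1 f = f1)
    (h2 : coeff 2 f = f2) : HasPowerSums f (-f1 / f0) ((f1 / f0) ^ 2 - 2 * f2 / f0) := by
  refine ⟨h0 ▸ h, ?_, ?_⟩
  · rw [h0, h1]
    field_simp
  · rw [h0, h2]
    field_simp
    ring

theorem unique (h : HasPowerSums f a b) (h' : HasPowerSums f a' b') : a = a' ∧ b = b' := by
  obtain ⟨h0, h1, h2⟩ := h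
  obtain ⟨-, h1', h2'⟩ := h'
  have ha : a = a' := neg_injective (mul_right_cancel₀ h0 (h1.symm.trans h1'))
  subst ha
  exact ⟨rfl, sub_right_injective (mul_right_cancel₀ h0 (h2.symm.trans h2'))⟩

theorem one : HasPowerSums (1 : K⟦X⟧) 0 0 := by
  simp [HasPowerSums, coeff_one]

/-- `HasPowerSums` says `-f'/f = a + b X + O(X²)`, and logarithmic derivatives are additive. -/
theorem mul (hf : HasPowerSums f a b) (hg : HasPowerSums g a' b') :
    HasPowerSums (f * g) (a + a') (b + b') := by
  obtain ⟨hf0, hf1, hf2⟩ := hf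
  obtain ⟨hg0, hg1, hg2⟩ := hg
  have h0 : coeff 0 (f * g) = coeff 0 f * coeff 0 g := by simp
  refine ⟨by rw [h0]; exact mul_ne_zero hf0 hg0, ?_, ?_⟩
  · rw [h0, coeff_one_mul_eq, hf1, hg1]
    ring
  · rw [h0, coeff_two_mul_eq, hf1, hg1]
    linear_combination coeff 0 g * hf2 + coeff 0 f * hg2

theorem pow (hf : HasPowerSums f a b) (n : ℕ) : HasPowerSums (f ^ n) (n * a) (n * b) := by
  induction n with
  | zero => simpa using one
  | succ n ih =>
    rw [pow_succ]
    convert ih.mul hf using 1 <;> push_cast <;> ring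

theorem prod {ι : Type*} (s : Finset ι) {f : ι → K⟦X⟧} {a b : ι → K}
    (h : ∀ i ∈ s, HasPowerSums (f i) (a i) (b i)) :
    HasPowerSums (∏ i ∈ s, f i) (∑ i ∈ s, a i) (∑ i ∈ s, b i) := by
  classical
  induction s using Finset.induction_on with
  | empty => simpa using one
  | insert i s hi ih =>
    rw [Finset.prod_insert hi, Finset.sum_insert hi, Finset.sum_insert hi]
    exact (h i (by simp)).mul (ih fun j hj => h j (by simp [hj]))

theorem X_sub_C {c : K} (hc : c ≠ 0) : HasPowerSums (X - C c) (1 / c) (1 / c ^ 2) := by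
  convert of_coeff (f := X - C c) (neg_ne_zero.2 hc) (f1 := 1) (f2 := 0) ?_ ?_ ?_ using 1
  · field_simp
  · field_simp
    ring
  · simp
  · simp
  · simp [coeff_X]

/-- A power of `X` times a series with nonzero constant coefficient determines both factors. -/
theorem eq_of_X_pow_mul_eq {m : ℕ} (hf : HasPowerSums f a b) (hg : HasPowerSums g a' b')
    (h : X ^ m * f = X * g) : f = g := by
  -- Compare orders of vanishing at `0`: `m = 0` would kill the constant term of `f`, `m ≥ 2` that
  -- of `g`.
  have key : m = 1 := by
    rcases m with _ | _ | m
    · exfalso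
      apply hf.1
      have := congrArg (coeff 0) h
      simpa using this
    · rfl
    · exfalso
      apply hg.1
      have h' : X * (X * (X ^ m * f)) = X * g := by
        rw [← h]
        ring
      rw [← mul_left_cancel₀ X_ne_zero h']
      simp
  subst key
  rw [pow_one] at h
  exact mul_left_cancel₀ X_ne_zero h

end HasPowerSums

end PowerSeries

/-! ### Recursion of the edge responses -/

/-- The response series `(p_k, q_k)` of the two-terminal network that replaces an edge after `k`
generations of adding edge vertices. -/
noncomputable def edgeResponse : ℕ → PowerSeries ℝ × PowerSeries ℝ
  | 0 => (1, 1)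
  | k + 1 =>
    let p := (edgeResponse k).1
    let q := (edgeResponse k).2
    let r := (PowerSeries.X - 2 * p)⁻¹
    (2 * p + q ^ 2 * r, q - q ^ 2 * r)

open PowerSeries

theorem edgeResponse_add_succ (k : ℕ) :
    (edgeResponse (k + 1)).1 + (edgeResponse (k + 1)).2 =
      2 * (edgeResponse k).1 + (edgeResponse k).2 := by
  simp only [edgeResponse]
  ring

theorem X_sub_two_mul_mul_edgeResponse_sub_succ (k : ℕ)
    (h : constantCoeff (X - 2 * (edgeResponse k).1) ≠ 0) :
    (X - 2 * (edgeResponse k).1) * ((edgeResponse (k + 1)).1 - (edgeResponse (k + 1)).2) =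
      (X - 2 * (edgeResponse k).1) * (2 * (edgeResponse k).1 - (edgeResponse k).2) +
        2 * (edgeResponse k).2 ^ 2 := by
  have hr := PowerSeries.inv_mul_cancel _ h
  simp only [edgeResponse]
  linear_combination 2 * (edgeResponse k).2 ^ 2 * hr

/-- The low coefficients of the response series, for the sum and the difference of `p_k, q_k`. -/
structure EdgeResponseCoeffs (k : ℕ) (a b : ℝ) : Prop where
  v0 : coeff 0 ((edgeResponse k).1 + (edgeResponse k).2) = 2 * b / a
  v1 : coeff 1 ((edgeResponse k).1 + (edgeResponse k).2) = -1 / 4 - b / 12 + b / (3 * a)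
  v2 : coeff 2 ((edgeResponse k).1 + (edgeResponse k).2) =
    -11 / 252 * b - 17 / 270 * (b / a) - 9 / 560 * (a / b) + a / 8 - a * b / 432
  u0 : coeff 0 ((edgeResponse k).1 - (edgeResponse k).2) = 0
  u1 : coeff 1 ((edgeResponse k).1 - (edgeResponse k).2) = (1 - b) / 4
  u2 : coeff 2 ((edgeResponse k).1 - (edgeResponse k).2) =
    -11 / 84 * b + 3 / 112 * (a / b) + a / 8 - a * b / 48
  u3 : coeff 3 ((edgeResponse k).1 - (edgeResponse k).2) =
    9 / 1288 * (a ^ 2 / b ^ 2) - a / (224 * b) - a ^ 2 / (560 * b) + 5 / 112 * a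
      - 4297 / 173880 * b - 37 / 2016 * (a * b) - a ^ 2 * b / 432

theorem coeff_ofNat_two_mul (n : ℕ) (f : PowerSeries ℝ) : coeff n (2 * f) = 2 * coeff n f := by
  rw [two_mul, map_add, two_mul]

/-- With `v = p + q` and `u = p - q`, the recursion at order `n` reads `v' = (3v + u) / 2` and `u' =
3u +` terms of lower order, so the coefficients follow one order at a time. The constant terms are
`p = q = (3/2) ^ k`. -/
theorem edgeResponseCoeffs (k : ℕ) : EdgeResponseCoeffs k (2 ^ k) (3 ^ k) := by
  induction k with
  | zero =>
    constructor <;> simp [edgeResponse, coeff_one] <;> norm_num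
  | succ k ih =>
    obtain ⟨v0, v1, v2, u0, u1, u2, u3⟩ := ih
    have ha : (2 : ℝ) ^ k ≠ 0 := by positivity
    have hb : (3 : ℝ) ^ k ≠ 0 := by positivity
    rw [pow_succ, pow_succ]
    generalize (2 : ℝ) ^ k = a at *
    generalize (3 : ℝ) ^ k = b at *
    set p := (edgeResponse k).1 with hp
    set q := (edgeResponse k).2 with hq
    have hv := edgeResponse_add_succ k
    have hu := X_sub_two_mul_mul_edgeResponse_sub_succ k
    rw [← hp, ← hq] at hv hu
    simp only [map_add, map_sub] at v0 v1 v2 u0 u1 u2 u3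
    have p0 : coeff 0 p = b / a := by linear_combination (v0 + u0) / 2
    have q0 : coeff 0 q = b / a := by linear_combination (v0 - u0) / 2
    have hne : constantCoeff (X - 2 * p) ≠ 0 := by
      rw [← coeff_zero_eq_constantCoeff_apply, map_sub, coeff_ofNat_two_mul, p0]
      simp [ha, hb]
    specialize hu hne
    set u := (edgeResponse (k + 1)).1 - (edgeResponse (k + 1)).2
    have w0 : coeff 0 (X - 2 * p) = -2 * (b / a) := by
      rw [map_sub, coeff_ofNat_two_mul, p0]; simp
    have w1 : coeff 1 (X - 2 * p) = 1 - 2 * coeff 1 p := by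
      rw [map_sub, coeff_ofNat_two_mul, coeff_one_X]
    have w2 : coeff 2 (X - 2 * p) = - 2 * coeff 2 p := by
      rw [map_sub, coeff_ofNat_two_mul, coeff_X]; simp
    have w3 : coeff 3 (X - 2 * p) = - 2 * coeff 3 p := by
      rw [map_sub, coeff_ofNat_two_mul, coeff_X]; simp
    have p1 : coeff 1 p = (-1 / 4 - b / 12 + b / (3 * a) + (1 - b) / 4) / 2 := by
      linear_combination (v1 + u1) / 2
    have q1 : coeff 1 q = (-1 / 4 - b / 12 + b / (3 * a) - (1 - b) / 4) / 2 := by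
      linear_combination (v1 - u1) / 2
    have p2 : coeff 2 p = (-11 / 252 * b - 17 / 270 * (b / a) - 9 / 560 * (a / b) + a / 8
        - a * b / 432 + (-11 / 84 * b + 3 / 112 * (a / b) + a / 8 - a * b / 48)) / 2 := by
      linear_combination (v2 + u2) / 2
    have q2 : coeff 2 q = (-11 / 252 * b - 17 / 270 * (b / a) - 9 / 560 * (a / b) + a / 8
        - a * b / 432 - (-11 / 84 * b + 3 / 112 * (a / b) + a / 8 - a * b / 48)) / 2 := by
      linear_combination (v2 - u2) / 2
    have hc2 : coeff 0 (2 : PowerSeries ℝ) = 2 ∧ coeff 1 (2 : PowerSeries ℝ) = 0 ∧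
        coeff 2 (2 : PowerSeries ℝ) = 0 ∧ coeff 3 (2 : PowerSeries ℝ) = 0 := by
      refine ⟨?_, ?_, ?_, ?_⟩ <;> rw [← mul_one (2 : PowerSeries ℝ), coeff_ofNat_two_mul] <;>
        simp [coeff_one]
    have hmul : ∀ f g : PowerSeries ℝ, coeff 0 (f * g) = coeff 0 f * coeff 0 g := by simp
    have e0 := congrArg (coeff 0) hu
    have e1 := congrArg (coeff 1) hu
    have e2 := congrArg (coeff 2) hu
    have e3 := congrArg (coeff 3) hu
    generalize X - 2 * p = w at *
    simp only [map_add, map_sub, sq q, coeff_one_mul_eq, coeff_two_mul_eq, coeff_three_mul_eq,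
      hmul, hc2, zero_mul, add_zero, w0, w1, w2, w3, p0, q0] at e0 e1 e2 e3
    have x0 : coeff 0 u = 0 := by
      have : b / a * coeff 0 u = 0 := by linear_combination (-1 / 2) * e0
      simpa [ha, hb] using this
    have hba : b / a ≠ 0 := div_ne_zero hb ha
    have x1 : coeff 1 u = (1 - b * 3) / 4 := by
      refine mul_left_cancel₀ hba ?_
      rw [x0, p1, q1] at e1
      linear_combination (-1 / 2) * e1
    have x2 : coeff 2 u = -11 / 84 * (b * 3) + 3 / 112 * (a * 2 / (b * 3)) + a * 2 / 8
        - a * 2 * (b * 3) / 48 := by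
      refine mul_left_cancel₀ hba ?_
      rw [x0, x1, p1, q1, p2, q2] at e2
      linear_combination (norm := skip) (-1 / 2) * e2
      field_simp
      ring
    have x3 : coeff 3 u = 9 / 1288 * ((a * 2) ^ 2 / (b * 3) ^ 2) - a * 2 / (224 * (b * 3))
        - (a * 2) ^ 2 / (560 * (b * 3)) + 5 / 112 * (a * 2) - 4297 / 173880 * (b * 3)
        - 37 / 2016 * (a * 2 * (b * 3)) - (a * 2) ^ 2 * (b * 3) / 432 := by
      refine mul_left_cancel₀ hba ?_
      rw [x0, x1, x2, p1, q1, p2, q2] at e3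
      -- The third coefficients of `p` and `q` enter only through their difference; this is why `v`
      -- is needed only to order two.
      linear_combination (norm := skip) (-1 / 2) * e3 + 3 * (b / a) * u3
      field_simp
      ring
    refine ⟨?_, ?_, ?_, x0, x1, x2, x3⟩
    · rw [hv, map_add, coeff_ofNat_two_mul, p0, q0]
      field_simp
      ring
    · rw [hv, map_add, coeff_ofNat_two_mul, p1, q1]
      field_simp
      ring
    · rw [hv, map_add, coeff_ofNat_two_mul, p2, q2]
      field_simp
      ring

/-! ### Contributions of eliminated vertices and of the triangle -/

/-- Sum of the reciprocals of the roots eliminated in the first `k` reductions of one edge, for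
`a = 2 ^ k` and `b = 3 ^ k`. -/
noncomputable def eliminatedSum (a b : ℝ) : ℝ :=
  1 / 12 + 25 / 84 * b - 3 / 14 * (a / b) - a / 6

/-- Sum of the squared reciprocals of the roots eliminated in the first `k` reductions of one edge,
for `a = 2 ^ k` and `b = 3 ^ k`. -/
noncomputable def eliminatedSqSum (a b : ℝ) : ℝ :=
  -603 / 6440 * (a ^ 2 / b ^ 2) + a / (14 * b) - 49 / 1080 + a ^ 2 / (20 * b) - 5 / 42 * a
    + 4967 / 57960 * b + 11 / 216 * a ^ 2

/-- Writing each contribution as `E (k + 1) - 3 * E k` makes the total over all generations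
telescope, since the number of edges triples. -/
theorem hasPowerSums_X_sub_two_mul_edgeResponse (k : ℕ) :
    HasPowerSums (X - 2 * (edgeResponse k).1)
      (eliminatedSum (2 ^ (k + 1)) (3 ^ (k + 1)) - 3 * eliminatedSum (2 ^ k) (3 ^ k))
      (eliminatedSqSum (2 ^ (k + 1)) (3 ^ (k + 1)) - 3 * eliminatedSqSum (2 ^ k) (3 ^ k)) := by
  obtain ⟨v0, v1, v2, u0, u1, u2, -⟩ := edgeResponseCoeffs k
  have ha : (2 : ℝ) ^ k ≠ 0 := by positivity
  have hb : (3 : ℝ) ^ k ≠ 0 := by positivity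
  rw [pow_succ, pow_succ]
  generalize (2 : ℝ) ^ k = a at *
  generalize (3 : ℝ) ^ k = b at *
  simp only [map_add, map_sub] at v0 v1 v2 u0 u1 u2
  have hne : -(2 * b / a) ≠ 0 := by simp [ha, hb]
  convert HasPowerSums.of_coeff (f := X - 2 * (edgeResponse k).1) hne
    (f1 := 1 - ((-1 / 4 - b / 12 + b / (3 * a)) + (1 - b) / 4))
    (f2 := - ((-11 / 252 * b - 17 / 270 * (b / a) - 9 / 560 * (a / b) + a / 8 - a * b / 432) +
      (-11 / 84 * b + 3 / 112 * (a / b) + a / 8 - a * b / 48))) ?_ ?_ ?_ using 1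
  · simp only [eliminatedSum]
    field_simp
    ring
  · simp only [eliminatedSqSum]
    field_simp
    ring
  · rw [map_sub, coeff_ofNat_two_mul, coeff_zero_X]
    linear_combination -v0 - u0
  · rw [map_sub, coeff_ofNat_two_mul, coeff_one_X]
    linear_combination -v1 - u1
  · rw [map_sub, coeff_ofNat_two_mul, coeff_X, if_neg (by norm_num)]
    linear_combination -v2 - u2

/-- Sum of the reciprocals of the nonzero eigenvalues of the triangle with edge responses of
generation `k`, for `a = 2 ^ k` and `b = 3 ^ k`. -/
noncomputable def triangleSum (a b : ℝ) : ℝ :=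
  (4 * (-11 / 84 * b + 3 / 112 * (a / b) + a / 8 - a * b / 48)) / (1 + b) +
    2 * ((5 / 4 + b / 4 - b / (2 * a)) * a / (3 * b))

/-- Sum of the squared reciprocals of the nonzero eigenvalues of the triangle with edge responses of
generation `k`, for `a = 2 ^ k` and `b = 3 ^ k`. -/
noncomputable def triangleSqSum (a b : ℝ) : ℝ :=
  ((4 * (-11 / 84 * b + 3 / 112 * (a / b) + a / 8 - a * b / 48)) / (1 + b)) ^ 2 +
    8 * (9 / 1288 * (a ^ 2 / b ^ 2) - a / (224 * b) - a ^ 2 / (560 * b) + 5 / 112 * a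
      - 4297 / 173880 * b - 37 / 2016 * (a * b) - a ^ 2 * b / 432) / (1 + b) +
    2 * (((5 / 4 + b / 4 - b / (2 * a)) * a / (3 * b)) ^ 2 -
      2 * (-11 / 84 * b - 17 / 180 * (b / a) - 3 / 280 * (a / b) + a / 4 - a * b / 72) * a / (3 * b))

theorem exists_X_mul_hasPowerSums_triangle (k : ℕ) :
    ∃ g, (X - 2 * (edgeResponse k).1 + 2 * (edgeResponse k).2) *
          (X - 2 * (edgeResponse k).1 - (edgeResponse k).2) ^ 2 = X * g ∧
      HasPowerSums g (triangleSum (2 ^ k) (3 ^ k)) (triangleSqSum (2 ^ k) (3 ^ k)) := by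
  obtain ⟨v0, v1, v2, -, -, -, -⟩ := edgeResponseCoeffs (k + 1)
  obtain ⟨-, -, -, u0, u1, u2, u3⟩ := edgeResponseCoeffs k
  -- The double factor `X - 2p - q` is `X` minus the sum of the responses of generation `k + 1`.
  rw [edgeResponse_add_succ] at v0 v1 v2
  have ha : (2 : ℝ) ^ k ≠ 0 := by positivity
  have hb : (0 : ℝ) < 3 ^ k := by positivity
  rw [pow_succ, pow_succ] at v0 v1 v2
  generalize (2 : ℝ) ^ k = a at *
  generalize (3 : ℝ) ^ k = b at *
  have hb' : b ≠ 0 := hb.ne'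
  have h1b : 1 + b ≠ 0 := by positivity
  set p := (edgeResponse k).1
  set q := (edgeResponse k).2
  -- The factor `X - 2(p - q)` carries the zero eigenvalue; dividing it by `X` shifts coefficients,
  -- so `p - q` is needed to order three.
  let g : PowerSeries ℝ := mk fun n => coeff (n + 1) (X - 2 * (p - q))
  have hg : X - 2 * p + 2 * q = X * g := by
    have h := sub_const_eq_X_mul_shift (X - 2 * (p - q))
    have h0 : constantCoeff (X - 2 * (p - q)) = 0 := by
      rw [← coeff_zero_eq_constantCoeff_apply, map_sub, coeff_ofNat_two_mul, u0]
      simp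
    rw [h0, map_zero, sub_zero] at h
    rw [← h]
    ring
  have hgs := HasPowerSums.of_coeff (f := g) (f0 := (1 + b) / 2)
    (f1 := - 2 * (-11 / 84 * b + 3 / 112 * (a / b) + a / 8 - a * b / 48))
    (f2 := - 2 * (9 / 1288 * (a ^ 2 / b ^ 2) - a / (224 * b) - a ^ 2 / (560 * b) + 5 / 112 * a
      - 4297 / 173880 * b - 37 / 2016 * (a * b) - a ^ 2 * b / 432)) (by simpa using h1b)
    (by
      rw [coeff_mk, map_sub, coeff_ofNat_two_mul, u1, zero_add, coeff_one_X]
      ring)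
    (by
      rw [coeff_mk, map_sub, coeff_ofNat_two_mul, u2, coeff_X, if_neg (by norm_num)]
      ring)
    (by
      rw [coeff_mk, map_sub, coeff_ofNat_two_mul, u3, coeff_X, if_neg (by norm_num)]
      ring)
  have hw := HasPowerSums.of_coeff (f := X - 2 * p - q) (f0 := - (3 * b / a))
    (f1 := 5 / 4 + b / 4 - b / (2 * a))
    (f2 := -(-11 / 84 * b - 17 / 180 * (b / a) - 3 / 280 * (a / b) + a / 4 - a * b / 72))
    (by simp [ha, hb'])
    (by
      rw [sub_sub, map_sub, v0, coeff_zero_X]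
      field_simp
      ring)
    (by
      rw [sub_sub, map_sub, v1, coeff_one_X]
      field_simp
      ring)
    (by
      rw [sub_sub, map_sub, v2, coeff_X, if_neg (by norm_num)]
      field_simp
      ring)
  refine ⟨g * (X - 2 * p - q) ^ 2, by rw [hg, mul_assoc], ?_⟩
  convert hgs.mul (hw.pow 2) using 1
  · simp only [triangleSum]
    push_cast
    field_simp
    ring
  · simp only [triangleSqSum]
    push_cast
    field_simp
    ring

/-! ### Counting, and assembly of the spectral sums -/

theorem natCard_edgeSet_psfw (n : ℕ) : Nat.card (psfw n).graph.edgeSet = 3 ^ (n + 1) := by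
  classical
  induction n with
  | zero =>
    have h := SimpleGraph.card_edgeFinset_top_eq_card_choose_two (V := Fin 3)
    rw [SimpleGraph.edgeFinset_card, ← Nat.card_eq_fintype_card] at h
    exact h
  | succ n ih =>
    rw [pow_succ, ← ih, mul_comm]
    exact (psfw n).graph.natCard_edgeSet_addEdgeVertices

theorem two_mul_psfwCard (n : ℕ) : 2 * psfwCard n = 3 ^ (n + 1) + 3 := by
  classical
  induction n with
  | zero => rfl
  | succ n ih =>
    have h : psfwCard (n + 1) = psfwCard n + 3 ^ (n + 1) := by
      rw [← natCard_edgeSet_psfw, psfwCard, psfwCard, ← Nat.card_eq_fintype_card,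
        ← Nat.card_eq_fintype_card]
      exact Nat.card_sum
    rw [h, mul_add, ih, pow_succ 3 (n + 1)]
    ring

theorem SimpleGraph.det_networkMatrix_congr_inst {V R : Type*} [CommRing R] (G : SimpleGraph V)
    (i₁ i₂ : Fintype V) (d₁ d₂ : DecidableEq V) (r₁ r₂ : DecidableRel G.Adj) (p q x : R) :
    @Matrix.det V d₁ i₁ R _ (@networkMatrix V R i₁ d₁ _ G r₁ p q x) =
      @Matrix.det V d₂ i₂ R _ (@networkMatrix V R i₂ d₂ _ G r₂ p q x) := by
  rw [Subsingleton.elim i₁ i₂, Subsingleton.elim d₁ d₂, Subsingleton.elim r₁ r₂]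

open Classical in
-- Induction needs every starting generation `k`: eliminating one generation of vertices replaces
-- `(n + 1, k)` by `(n, k + 1)`.
theorem exists_det_networkMatrix_psfw (n k : ℕ) :
    ∃ g, ((psfw n).graph.networkMatrix (edgeResponse k).1 (edgeResponse k).2 X).det = X * g ∧
      HasPowerSums g
        (triangleSum (2 ^ (n + k)) (3 ^ (n + k)) + 3 * eliminatedSum (2 ^ (n + k)) (3 ^ (n + k))
          - 3 ^ (n + 1) * eliminatedSum (2 ^ k) (3 ^ k))
        (triangleSqSum (2 ^ (n + k)) (3 ^ (n + k)) + 3 * eliminatedSqSum (2 ^ (n + k)) (3 ^ (n + k))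
          - 3 ^ (n + 1) * eliminatedSqSum (2 ^ k) (3 ^ k)) := by
  induction n generalizing k with
  | zero =>
    obtain ⟨g, hg, hs⟩ := exists_X_mul_hasPowerSums_triangle k
    refine ⟨g, ?_, by simpa using hs⟩
    rw [← hg, ← SimpleGraph.det_networkMatrix_top_fin_three]
    exact SimpleGraph.det_networkMatrix_congr_inst (⊤ : SimpleGraph (Fin 3)) _ _ _ _ _ _ _ _ _
  | succ n ih =>
    obtain ⟨g, hg, hs⟩ := ih (k + 1)
    have hX := hasPowerSums_X_sub_two_mul_edgeResponse k
    refine ⟨(X - 2 * (edgeResponse k).1) ^ 3 ^ (n + 1) * g, ?_, ?_⟩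
    · have h := (psfw n).graph.det_networkMatrix_addEdgeVertices (edgeResponse k).1
        (edgeResponse k).2 X _ (PowerSeries.inv_mul_cancel _ (by simpa using hX.1))
      rw [← Nat.card_eq_fintype_card, natCard_edgeSet_psfw] at h
      rw [mul_left_comm, ← hg]
      exact (SimpleGraph.det_networkMatrix_congr_inst (psfw n).graph.addEdgeVertices
        _ _ _ _ _ _ _ _ _).trans h
    · convert (hX.pow (3 ^ (n + 1))).mul hs using 1
      · rw [Nat.add_right_comm n 1 k, add_assoc n k 1]
        push_cast
        ring
      · rw [Nat.add_right_comm n 1 k, add_assoc n k 1]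
        push_cast
        ring

open Classical in
theorem prod_X_sub_C_eq_X_pow_mul {K ι : Type*} [Field K] [Fintype ι] (c : ι → K) :
    ∏ i, (X - C (c i)) =
      X ^ (Finset.univ.filter fun i => ¬ c i ≠ 0).card * ∏ i with c i ≠ 0, (X - C (c i)) := by
  rw [← Finset.prod_filter_not_mul_prod_filter (p := fun i => c i ≠ 0), ← Finset.prod_const]
  congr 1
  refine Finset.prod_congr rfl fun i hi => ?_
  rw [not_not.1 (Finset.mem_filter.1 hi).2, map_zero, sub_zero]

open Classical in
theorem sum_inv_lapEigenvalues_psfw (n : ℕ) :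
    ∑ i : (psfw n).V with (psfw n).lapEigenvalues i ≠ 0, 1 / (psfw n).lapEigenvalues i =
        triangleSum (2 ^ n) (3 ^ n) + 3 * eliminatedSum (2 ^ n) (3 ^ n) ∧
      ∑ i : (psfw n).V with (psfw n).lapEigenvalues i ≠ 0, 1 / (psfw n).lapEigenvalues i ^ 2 =
        triangleSqSum (2 ^ n) (3 ^ n) + 3 * eliminatedSqSum (2 ^ n) (3 ^ n) := by
  obtain ⟨g, hg, hs⟩ := exists_det_networkMatrix_psfw n 0
  have h := (psfw n).graph.det_networkMatrix_one_one
    (Polynomial.coeToPowerSeries.ringHom (R := ℝ))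
  rw [((psfw n).graph.isHermitian_lapMatrix (R := ℝ)).charpoly_eq, map_prod] at h
  simp only [map_sub, Polynomial.coeToPowerSeries.ringHom_apply, Polynomial.coe_X,
    Polynomial.coe_C] at h
  -- The exponent is the multiplicity of the eigenvalue `0`. That it equals `1` comes from this
  -- comparison, without a connectivity argument.
  have hprod : X ^ _ * _ = X * g :=
    (prod_X_sub_C_eq_X_pow_mul (psfw n).lapEigenvalues).symm.trans (h.symm.trans hg)
  have hs' := HasPowerSums.prod (Finset.univ.filter fun i => (psfw n).lapEigenvalues i ≠ 0)
    fun i hi => HasPowerSums.X_sub_C (Finset.mem_filter.1 hi).2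
  rw [← hs'.eq_of_X_pow_mul_eq hs hprod] at hs
  obtain ⟨h1, h2⟩ := hs'.unique hs
  have e1 : eliminatedSum 1 1 = 0 := by norm_num [eliminatedSum]
  have e2 : eliminatedSqSum 1 1 = 0 := by norm_num [eliminatedSqSum]
  simp only [add_zero, pow_zero, e1, e2, mul_zero, sub_zero] at h1 h2
  exact ⟨h1, h2⟩

/-! ### Closed forms -/

theorem two_mul_card_psfw (n : ℕ) : 2 * (Fintype.card (psfw n).V : ℝ) = 3 * (1 + 3 ^ n) := by
  have h := two_mul_psfwCard n
  rw [psfwCard] at h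
  have h' : ((2 * Fintype.card (psfw n).V : ℕ) : ℝ) = ((3 ^ (n + 1) + 3 : ℕ) : ℝ) := by rw [h]
  push_cast at h'
  rw [h', pow_succ]
  ring

theorem firstOrderCoherence_psfw (n : ℕ) :
    (psfw n).firstOrderCoherence =
      1 / (28 * (1 + (3 : ℝ) ^ n) ^ 2 * 3 ^ (2 + n)) *
        (25 * 2 ^ n - 7 * 3 ^ n + 8 * 3 ^ (1 + 2 * n) + 25 * 3 ^ (1 + 3 * n)
          + 5 * 6 ^ (1 + n) - 35 * 18 ^ n) := by
  rw [FinGraph.firstOrderCoherence, (sum_inv_lapEigenvalues_psfw n).1, two_mul_card_psfw,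
    show (6 : ℝ) = 2 * 3 by norm_num, show (18 : ℝ) = 2 * 3 ^ 2 by norm_num]
  simp only [pow_add, pow_mul', mul_pow, pow_right_comm (3 : ℝ) 2 n, triangleSum, eliminatedSum]
  have ha : (0 : ℝ) < 2 ^ n := by positivity
  have hb : (0 : ℝ) < 3 ^ n := by positivity
  generalize (2 : ℝ) ^ n = a at *
  generalize (3 : ℝ) ^ n = b at *
  field_simp
  ring

theorem three_zpow_neg_four_sub_two_mul (n : ℕ) :
    (3 : ℝ) ^ (-4 - 2 * (n : ℤ)) = 1 / (81 * (3 ^ n) ^ 2) := by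
  rw [zpow_sub₀ (by norm_num), mul_comm 2 (n : ℤ), zpow_mul, zpow_natCast]
  norm_num
  field_simp

theorem secondOrderCoherence_psfw (n : ℕ) :
    (psfw n).secondOrderCoherence =
      (3 : ℝ) ^ (-4 - 2 * (n : ℤ)) / (90160 * (1 + (3 : ℝ) ^ n) ^ 3) *
        (69538 * 3 ^ (2 + 5 * n) + 360249 * 4 ^ n
          + 35 * 2 ^ (2 + n) * 3 ^ (1 + n) * (-575 + 1539 * 2 ^ n)
          + 322 * 27 ^ n * (1135 - 3225 * 2 ^ (1 + n) + 847 * 2 ^ (1 + 2 * n))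
          + 3 ^ (1 + 4 * n) * (516262 - 60375 * 2 ^ (2 + n) + 140875 * 4 ^ n)
          + 2 * 9 ^ n * (55223 - 94875 * 2 ^ (1 + n) + 480487 * 4 ^ n)) := by
  rw [FinGraph.secondOrderCoherence, (sum_inv_lapEigenvalues_psfw n).2, two_mul_card_psfw, three_zpow_neg_four_sub_two_mul,
    show (4 : ℝ) = 2 ^ 2 by norm_num, show (27 : ℝ) = 3 ^ 3 by norm_num,
    show (9 : ℝ) = 3 ^ 2 by norm_num]
  simp only [pow_add, pow_mul', pow_right_comm (3 : ℝ) _ n, pow_right_comm (2 : ℝ) _ n,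
    triangleSqSum, eliminatedSqSum]
  have ha : (0 : ℝ) < 2 ^ n := by positivity
  have hb : (0 : ℝ) < 3 ^ n := by positivity
  generalize (2 : ℝ) ^ n = a at *
  generalize (3 : ℝ) ^ n = b at *
  field_simp
  ring

/-! ### Asymptotics -/

theorem tendsto_firstOrderCoherence_psfw :
    Tendsto (fun n : ℕ => (psfw n).firstOrderCoherence) atTop (nhds (25 / 84)) := by
  have hx : Tendsto (fun n : ℕ => (1 / 3 : ℝ) ^ n) atTop (nhds 0) :=
    tendsto_pow_atTop_nhds_zero_of_lt_one (by norm_num) (by norm_num)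
  have hy : Tendsto (fun n : ℕ => (2 / 3 : ℝ) ^ n) atTop (nhds 0) :=
    tendsto_pow_atTop_nhds_zero_of_lt_one (by norm_num) (by norm_num)
  -- The closed form with numerator and denominator divided by `27 ^ n`, as a function of `(1/3) ^
  -- n` and `(2/3) ^ n`.
  have hc : ContinuousAt (fun z : ℝ × ℝ =>
      (25 * z.1 ^ 2 * z.2 - 7 * z.1 ^ 2 + 24 * z.1 + 75 + 30 * z.1 * z.2 - 35 * z.2) /
        (252 * (z.1 + 1) ^ 2)) (0, 0) := by
    refine ContinuousAt.div (by fun_prop) (by fun_prop) (by norm_num)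
  have h := hc.tendsto.comp (hx.prodMk_nhds hy)
  norm_num at h
  refine h.congr fun n => ?_
  rw [firstOrderCoherence_psfw, show (6 : ℝ) = 2 * 3 by norm_num,
    show (18 : ℝ) = 2 * 3 ^ 2 by norm_num]
  simp only [Function.comp, pow_add, pow_mul', mul_pow, div_pow, one_pow,
    pow_right_comm (3 : ℝ) 2 n]
  have hb : (0 : ℝ) < 3 ^ n := by positivity
  generalize (2 : ℝ) ^ n = a at *
  generalize (3 : ℝ) ^ n = b at *
  field_simp
  ring

theorem tendsto_secondOrderCoherence_psfw_div :
    Tendsto (fun n : ℕ => (psfw n).secondOrderCoherence / (4 / 3 : ℝ) ^ n) atTop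
      (nhds (25 / 432)) := by
  have hx : Tendsto (fun n : ℕ => (1 / 3 : ℝ) ^ n) atTop (nhds 0) :=
    tendsto_pow_atTop_nhds_zero_of_lt_one (by norm_num) (by norm_num)
  have hy : Tendsto (fun n : ℕ => (1 / 2 : ℝ) ^ n) atTop (nhds 0) :=
    tendsto_pow_atTop_nhds_zero_of_lt_one (by norm_num) (by norm_num)
  have hw : Tendsto (fun n : ℕ => (3 / 4 : ℝ) ^ n) atTop (nhds 0) :=
    tendsto_pow_atTop_nhds_zero_of_lt_one (by norm_num) (by norm_num)
  -- Here the numerator is divided by its dominant monomial `4 ^ n * 81 ^ n`; the value at the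
  -- origin is `3 * 140875 / 7302960 = 25 / 432`.
  have hc : ContinuousAt (fun z : (ℝ × ℝ) × ℝ =>
      (625842 * z.2 + 360249 * z.1.1 ^ 4
        + 420 * (-575 * z.1.2 + 1539) * z.1.1 ^ 3
        + 322 * (1135 * z.1.2 ^ 2 - 6450 * z.1.2 + 1694) * z.1.1
        + 3 * (516262 * z.1.2 ^ 2 - 241500 * z.1.2 + 140875)
        + 2 * (55223 * z.1.2 ^ 2 - 189750 * z.1.2 + 480487) * z.1.1 ^ 2) /
        (7302960 * (z.1.1 + 1) ^ 3)) ((0, 0), 0) := by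
    refine ContinuousAt.div (by fun_prop) (by fun_prop) (by norm_num)
  have h := hc.tendsto.comp ((hx.prodMk_nhds hy).prodMk_nhds hw)
  norm_num at h
  refine h.congr fun n => ?_
  rw [secondOrderCoherence_psfw, three_zpow_neg_four_sub_two_mul, show (4 : ℝ) = 2 ^ 2 by norm_num,
    show (27 : ℝ) = 3 ^ 3 by norm_num, show (9 : ℝ) = 3 ^ 2 by norm_num]
  simp only [Function.comp, pow_add, pow_mul', div_pow, one_pow,
    pow_right_comm (3 : ℝ) _ n, pow_right_comm (2 : ℝ) _ n]
  have ha : (0 : ℝ) < 2 ^ n := by positivity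
  have hb : (0 : ℝ) < 3 ^ n := by positivity
  generalize (2 : ℝ) ^ n = a at *
  generalize (3 : ℝ) ^ n = b at *
  field_simp
  ring

theorem logb_three_four_sub_one_pos : 0 < Real.logb 3 4 - 1 := by
  rw [sub_pos, Real.lt_logb_iff_rpow_lt (by norm_num) (by norm_num)]
  norm_num

theorem logb_three_four_sub_one_lt_one : Real.logb 3 4 - 1 < 1 := by
  rw [sub_lt_iff_lt_add, Real.logb_lt_iff_lt_rpow (by norm_num) (by norm_num),
    show (1 + 1 : ℝ) = (2 : ℕ) by norm_num, Real.rpow_natCast]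
  norm_num

theorem three_pow_rpow_logb (n : ℕ) :
    ((3 : ℝ) ^ n) ^ (Real.logb 3 4 - 1) = (4 / 3) ^ n := by
  rw [← Real.rpow_natCast, ← Real.rpow_mul (by norm_num), mul_comm, Real.rpow_mul (by norm_num),
    Real.rpow_natCast, Real.rpow_sub (by norm_num), Real.rpow_logb (by norm_num) (by norm_num)
    (by norm_num), Real.rpow_one]

theorem secondOrderCoherence_psfw_isEquivalent :
    (fun n : ℕ => (psfw n).secondOrderCoherence) ~[atTop]
      (fun n : ℕ => 25 / 432 * (2 / 3 * (psfwCard n : ℝ)) ^ (Real.logb 3 4 - 1)) := by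
  have hN : ∀ n, 2 / 3 * (psfwCard n : ℝ) = 3 ^ n * (1 + (1 / 3) ^ n) := fun n => by
    have h : 2 * (psfwCard n : ℝ) = 3 * (1 + 3 ^ n) := two_mul_card_psfw n
    rw [mul_add, ← mul_pow]
    norm_num
    linear_combination h / 3
  have hx : Tendsto (fun n : ℕ => (1 / 3 : ℝ) ^ n) atTop (nhds 0) :=
    tendsto_pow_atTop_nhds_zero_of_lt_one (by norm_num) (by norm_num)
  have h1 : Tendsto (fun n : ℕ => (1 + (1 / 3 : ℝ) ^ n) ^ (Real.logb 3 4 - 1)) atTop (nhds 1) := by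
    have := (hx.const_add 1).rpow_const (p := Real.logb 3 4 - 1) (Or.inl (by norm_num))
    simpa using this
  have h2 := (tendsto_secondOrderCoherence_psfw_div.div (h1.const_mul (25 / 432)) (by norm_num))
  rw [isEquivalent_iff_tendsto_one]
  · convert h2 using 1
    · ext n
      have : 0 ≤ 1 + (1 / 3 : ℝ) ^ n := by positivity
      rw [Pi.div_apply, hN, Real.mul_rpow (by positivity) this, three_pow_rpow_logb,
        Pi.div_apply, div_div]
      congr 1
      ring
    · norm_num
  · refine Eventually.of_forall fun n => ?_
    rw [hN]
    positivity

theorem secondOrderCoherence_psfw_isLittleO :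
    (fun n : ℕ => (psfw n).secondOrderCoherence) =o[atTop] (fun n : ℕ => (psfwCard n : ℝ)) := by
  have hN : ∀ n, (psfwCard n : ℝ) = 3 / 2 * (1 + 3 ^ n) := fun n => by
    have h : 2 * (psfwCard n : ℝ) = 3 * (1 + 3 ^ n) := two_mul_card_psfw n
    linear_combination h / 2
  have h1 : (fun n : ℕ => (psfw n).secondOrderCoherence) =O[atTop] fun n : ℕ => (4 / 3 : ℝ) ^ n :=
    isBigO_of_div_tendsto_nhds (Eventually.of_forall fun n h => absurd h (by positivity)) _
      tendsto_secondOrderCoherence_psfw_div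
  have h2 : (fun n : ℕ => (4 / 3 : ℝ) ^ n) =o[atTop] fun n : ℕ => (3 : ℝ) ^ n :=
    isLittleO_pow_pow_of_lt_left (by norm_num) (by norm_num)
  refine (h1.trans_isLittleO h2).trans_isBigO (IsBigO.of_bound 1 (Eventually.of_forall fun n => ?_))
  rw [hN, one_mul, Real.norm_of_nonneg (by positivity), Real.norm_of_nonneg (by positivity)]
  have : (0 : ℝ) < 3 ^ n := by positivity
  linarith

theorem theorem1 :
    (∀ n : ℕ, 1 ≤ n →
      (psfw n).firstOrderCoherence =
        1 / (28 * (1 + (3 : ℝ) ^ n) ^ 2 * 3 ^ (2 + n)) *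
          (25 * 2 ^ n - 7 * 3 ^ n + 8 * 3 ^ (1 + 2 * n) + 25 * 3 ^ (1 + 3 * n)
            + 5 * 6 ^ (1 + n) - 35 * 18 ^ n)) ∧
    (∀ n : ℕ, 1 ≤ n →
      (psfw n).secondOrderCoherence =
        (3 : ℝ) ^ (-4 - 2 * (n : ℤ)) / (90160 * (1 + (3 : ℝ) ^ n) ^ 3) *
          (69538 * 3 ^ (2 + 5 * n) + 360249 * 4 ^ n
            + 35 * 2 ^ (2 + n) * 3 ^ (1 + n) * (-575 + 1539 * 2 ^ n)
            + 322 * 27 ^ n * (1135 - 3225 * 2 ^ (1 + n) + 847 * 2 ^ (1 + 2 * n))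
            + 3 ^ (1 + 4 * n) * (516262 - 60375 * 2 ^ (2 + n) + 140875 * 4 ^ n)
            + 2 * 9 ^ n * (55223 - 94875 * 2 ^ (1 + n) + 480487 * 4 ^ n))) ∧
    Tendsto (fun n : ℕ => (psfw n).firstOrderCoherence) atTop (nhds (25 / 84)) ∧
    (fun n : ℕ => (psfw n).secondOrderCoherence) ~[atTop]
      (fun n : ℕ => 25 / 432 * (2 / 3 * (psfwCard n : ℝ)) ^ (Real.logb 3 4 - 1)) ∧
    (0 < Real.logb 3 4 - 1 ∧ Real.logb 3 4 - 1 < 1) ∧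
    (fun n : ℕ => (psfw n).secondOrderCoherence) =o[atTop] (fun n : ℕ => (psfwCard n : ℝ)) :=
  ⟨fun n _ => firstOrderCoherence_psfw n, fun n _ => secondOrderCoherence_psfw n,
    tendsto_firstOrderCoherence_psfw, secondOrderCoherence_psfw_isEquivalent,
    ⟨logb_three_four_sub_one_pos, logb_three_four_sub_one_lt_one⟩,
    secondOrderCoherence_psfw_isLittleO⟩
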